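/- Let $n\ge 3$ and let $\ell_1,\dots,\ell_n>0$ be real numbers. Call a convex polygon in the hyperbolic plane \emph{cyclic} if its vertices lie on a curve of constant non-zero curvature, that is, on a hyperbolic circle (of positive radius), on a horocycle, or on a hypercycle (the set of the points on one side of a geodesic that have a fixed positive distance from this geodesic). There exists a hyperbolic cyclic polygon with $n$ sides whose consecutive side lengths are, in cyclic order, $\ell_1,\dots,\ell_n$ if and only if $$\ell_k<\sum_{\substack{i=1\\ i\ne k}}^{n}\ell_i\qquad\text{for all }k\in\{1,\dots,n\}.$$ This polygon is unique up to isometry: if two hyperbolic cyclic polygons with vertices $p_1,\dots,p_n$ and $q_1,\dots,q_n$ both have the side lengths $\ell_1,\dots,\ell_n$ in this order (the side from $p_k$ to $p_{k+1}$ and the side from $q_k$ to $q_{k+1}$ have length $\ell_k$, indices modulo $n$), then there is an isometry of the hyperbolic plane that maps $p_k$ to $q_k$ for every $k$. -/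

import Mathlib

/-- The scalar product `⟨x, y⟩ = x₁ y₁ + x₂ y₂ - x₃ y₃` of the vector space `ℝ^{2,1}`. -/
def mink (x y : Fin 3 → ℝ) : ℝ := x 0 * y 0 + x 1 * y 1 - x 2 * y 2

/-- The hyperbolic plane in the hyperboloid model. -/
abbrev HypPlane : Type := {x : Fin 3 → ℝ // mink x x = -1 ∧ 0 < x 2}

/-- The hyperbolic distance, determined by `cosh (hypDist x y) = -⟨x, y⟩` and
`0 ≤ hypDist x y`. -/
noncomputable def hypDist (x y : HypPlane) : ℝ := Real.arcosh (-mink x y)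

/-- The set of points of the hyperbolic plane that are orthogonal to `ν`. When `⟨ν, ν⟩ > 0` it is
a geodesic, and all geodesics arise so (the intersections of the hyperboloid with the
two-dimensional subspaces that meet it). The two sides of the geodesic are `⟨ν, x⟩ > 0` and
`⟨ν, x⟩ < 0`. -/
def hypLine (ν : Fin 3 → ℝ) : Set HypPlane := {x : HypPlane | mink ν x = 0}

/-- Hyperbolic circles of positive radius. -/
def IsHypCircle (C : Set HypPlane) : Prop :=
  ∃ (c : HypPlane) (r : ℝ), 0 < r ∧ C = {x : HypPlane | hypDist x c = r}

/-- Horocycles: the intersections of the hyperboloid with the lightlike affine planes that meet it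
(these planes have a lightlike normal vector, which can be chosen to point to the future). -/
def IsHorocycle (C : Set HypPlane) : Prop :=
  ∃ (ν : Fin 3 → ℝ) (c : ℝ), mink ν ν = 0 ∧ 0 < ν 2 ∧ 0 < c ∧ C = {x : HypPlane | mink ν x = -c}

/-- Hypercycles: the points on one side of a geodesic that have a given positive distance `R` from
that geodesic (the minimum of the distances to its points is `R`). -/
def IsHypercycle (C : Set HypPlane) : Prop :=
  ∃ (ν : Fin 3 → ℝ) (R : ℝ), 0 < mink ν ν ∧ 0 < R ∧
    C = {x : HypPlane | 0 < mink ν x ∧ IsLeast (hypDist x '' hypLine ν) R}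

/-- The curves of constant non-zero curvature. -/
def IsConstCurvatureCurve (C : Set HypPlane) : Prop :=
  IsHypCircle C ∨ IsHorocycle C ∨ IsHypercycle C

/-- `p 0, p 1, …, p (n - 1)` are, in this cyclic order, the vertices of a convex polygon:
they are pairwise distinct, and for every side `p k, p (k + 1)` (indices modulo `n`) there is a
geodesic through its two endpoints that has all the other vertices strictly on one side. -/
def IsConvexPolygon {n : ℕ} [NeZero n] (p : Fin n → HypPlane) : Prop :=
  Function.Injective p ∧
    ∀ k : Fin n, ∃ ν : Fin 3 → ℝ, 0 < mink ν ν ∧ p k ∈ hypLine ν ∧ p (k + 1) ∈ hypLine ν ∧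
      ∀ j : Fin n, j ≠ k → j ≠ k + 1 → 0 < mink ν (p j)

/-- A cyclic polygon: a convex polygon with its vertices on a curve of constant non-zero
curvature. -/
def IsCyclicPolygon {n : ℕ} [NeZero n] (p : Fin n → HypPlane) : Prop :=
  IsConvexPolygon p ∧ ∃ C : Set HypPlane, IsConstCurvatureCurve C ∧ ∀ k, p k ∈ C

/-- The side from `p k` to `p (k + 1)` (indices modulo `n`) has length `ℓ k`. -/
def HasSideLengths {n : ℕ} [NeZero n] (p : Fin n → HypPlane) (ℓ : Fin n → ℝ) : Prop :=
  ∀ k : Fin n, hypDist (p k) (p (k + 1)) = ℓ k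

/-!
Curves of constant non-zero curvature are the sections of the hyperboloid by affine planes
`⟨w, x⟩ = -1` with `⟨w, w⟩ > -1`. Put `κ = 1 / (1 + ⟨w, w⟩) - 1`, a number in `(-1, ∞)`. It is
positive for circles, zero for horocycles, and negative for hypercycles; the excluded value `-1`
belongs to geodesics. Starting from one of its points, such a section is parametrised by
generalised sines and cosines `S, C` with `C² + κ S² = 1`: after an isometry, its points are
`(2 S C, 2 S² √(κ + 1), 1 + 2 S²)` (`exists_isometry_normal_form`, `exists_eq_stdPoint`). Two such
points satisfy `⟨x, x'⟩ = -1 - 2 (S' C - S C')²`. So `sinh` of half their distance is the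
generalised sine of the difference of the arguments (`mink_stdPoint`, `mink_eq_sinh_half`), and the
three types of curves are treated at once.

Let the last side `ℓ_N` of a polygon with the vertices `0, …, N` be longest. Convexity says that
all triangles formed by a side and another vertex have the same orientation, that is, that the
vertices are in order on the conic. The arcs of the other sides then are at most quarter turns of
the parameter (`eq_arcSin_arcCos`). Therefore, with `a k = sinh (ℓ_k / 2)`, the vertices are
determined by `κ` and the `a k` for `k < N` through the addition theorem (`arcSinCos`), and the only
remaining condition is that the half chord `arcSin κ a N` of the sum of the arcs is equal to `a N`.

The main point is that `arcSin κ a N` is strictly decreasing in `κ` as long as the partial sums have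
positive sines (`arcSin_lt_of_lt`). Indeed, the cotangent `T` of a partial sum and the cotangent `U`
of the next arc give the new cotangent `U - 1 / (a² (T + U))` and multiply the sine by `a (T + U)`;
both `T` and `U` decrease with `κ`. This shows that `κ` is unique, hence that the polygon is unique
up to isometry. For `κ = -1` the half chord is `sinh (∑_{k < N} ℓ_k / 2)` (`arcSin_neg_one`), so
monotonicity gives the necessity of the polygon inequality. Conversely, if this inequality holds,
then the half chord is greater than `a N` at `κ = -1`, and it is at most `a N` at `κ = 1 / (a N)²`,
where `a N` is half the diameter of the circle. The first `κ` where it is equal to `a N` gives the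
polygon (`exists_arcSin_eq`, `exists_isCyclicPolygon`).
-/

/-! ### Generalised sines and cosines of arcs -/

/-- Generalised sine and cosine of a sum of arcs. For the parameter `κ`, let `S` be the solution
of `S'' = -κ S`, `S 0 = 0`, `S' 0 = 1`, and let `C = S'`. The `j`-th term is `(S t, C t)`, where
`t` is the sum of the first `j` of the arcs in `[0, π / (2 √κ)]` (in `[0, ∞)` if `κ ≤ 0`) whose
values of `S` are `a 0, a 1, …`. The recursion is the addition theorem, so that no inverse
functions and no case distinction on the sign of `κ` are needed. -/
noncomputable def arcSinCos (κ : ℝ) (a : ℕ → ℝ) : ℕ → ℝ × ℝ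
  | 0 => (0, 1)
  | k + 1 => ((arcSinCos κ a k).1 * √(1 - κ * a k ^ 2) + (arcSinCos κ a k).2 * a k,
      (arcSinCos κ a k).2 * √(1 - κ * a k ^ 2) - κ * (arcSinCos κ a k).1 * a k)

/-- The generalised sine of the sum of the first `j` arcs. -/
noncomputable def arcSin (κ : ℝ) (a : ℕ → ℝ) (j : ℕ) : ℝ := (arcSinCos κ a j).1

/-- The generalised cosine of the sum of the first `j` arcs. -/
noncomputable def arcCos (κ : ℝ) (a : ℕ → ℝ) (j : ℕ) : ℝ := (arcSinCos κ a j).2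

@[simp] lemma arcSin_zero (κ : ℝ) (a : ℕ → ℝ) : arcSin κ a 0 = 0 := rfl

@[simp] lemma arcCos_zero (κ : ℝ) (a : ℕ → ℝ) : arcCos κ a 0 = 1 := rfl

lemma arcSin_succ (κ : ℝ) (a : ℕ → ℝ) (k : ℕ) :
    arcSin κ a (k + 1) = arcSin κ a k * √(1 - κ * a k ^ 2) + arcCos κ a k * a k := rfl

lemma arcCos_succ (κ : ℝ) (a : ℕ → ℝ) (k : ℕ) :
    arcCos κ a (k + 1) = arcCos κ a k * √(1 - κ * a k ^ 2) - κ * arcSin κ a k * a k := rfl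

lemma arcCos_sq_add {κ : ℝ} {a : ℕ → ℝ} {j : ℕ} (h : ∀ k < j, κ * a k ^ 2 ≤ 1) :
    arcCos κ a j ^ 2 + κ * arcSin κ a j ^ 2 = 1 := by
  induction j with
  | zero => simp
  | succ k ih =>
    have h1 := ih fun i hi => h i (by omega)
    have h2 := Real.sq_sqrt (sub_nonneg.2 (h k (by omega)))
    rw [arcSin_succ, arcCos_succ]
    linear_combination (√(1 - κ * a k ^ 2) ^ 2 + κ * a k ^ 2) * h1 + h2

/-- The half chord between two consecutive points is the prescribed one. -/
lemma arcSin_succ_mul_arcCos_sub {κ : ℝ} {a : ℕ → ℝ} {j : ℕ} (h : ∀ k < j, κ * a k ^ 2 ≤ 1) :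
    arcSin κ a (j + 1) * arcCos κ a j - arcSin κ a j * arcCos κ a (j + 1) = a j := by
  have h1 := arcCos_sq_add h
  rw [arcSin_succ, arcCos_succ]
  linear_combination a j * h1

/-- For `κ = -1` the arcs are those of a geodesic, and the sine is the hyperbolic one. -/
lemma arcSin_neg_one (L : ℕ → ℝ) (j : ℕ) :
    arcSin (-1) (fun k => Real.sinh (L k)) j = Real.sinh (∑ k ∈ Finset.range j, L k) ∧
    arcCos (-1) (fun k => Real.sinh (L k)) j = Real.cosh (∑ k ∈ Finset.range j, L k) := by
  induction j with
  | zero => simp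
  | succ k ih =>
    have h : √(1 - -1 * Real.sinh (L k) ^ 2) = Real.cosh (L k) := by
      rw [show 1 - -1 * Real.sinh (L k) ^ 2 = Real.cosh (L k) ^ 2 by rw [Real.cosh_sq]; ring,
        Real.sqrt_sq (Real.cosh_pos _).le]
    rw [arcSin_succ, arcCos_succ, Finset.sum_range_succ, Real.sinh_add, Real.cosh_add, ih.1, ih.2,
      h]
    constructor <;> ring

lemma arcSin_pos_of_nonpos {κ : ℝ} {a : ℕ → ℝ} {j : ℕ} (hκ : κ ≤ 0) (ha : ∀ k < j, 0 < a k) :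
    (0 < j → 0 < arcSin κ a j) ∧ 0 ≤ arcSin κ a j ∧ 0 < arcCos κ a j := by
  induction j with
  | zero => simp
  | succ k ih =>
    obtain ⟨-, h1, h2⟩ := ih fun i hi => ha i (by omega)
    have h3 := ha k (by omega)
    have h4 : 0 < √(1 - κ * a k ^ 2) := Real.sqrt_pos.2 (by nlinarith [sq_nonneg (a k)])
    have h5 : 0 < arcSin κ a (k + 1) := by rw [arcSin_succ]; positivity
    refine ⟨fun _ => h5, h5.le, ?_⟩
    rw [arcCos_succ]
    have : 0 ≤ -κ * (arcSin κ a k * a k) := mul_nonneg (by linarith) (by positivity)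
    nlinarith [mul_pos h2 h4]

lemma continuous_arcSinCos (a : ℕ → ℝ) (j : ℕ) :
    Continuous (fun κ => arcSin κ a j) ∧ Continuous (fun κ => arcCos κ a j) := by
  induction j with
  | zero => exact ⟨continuous_const, continuous_const⟩
  | succ k ih =>
    obtain ⟨h1, h2⟩ := ih
    simp only [arcSin_succ, arcCos_succ]
    constructor <;> fun_prop

/-! ### Dependence on the curvature parameter -/

/-- If `κ` grows, the cotangents `arcCos / arcSin` and the half chords `arcSin` from the first
vertex become smaller, as long as the half chords are positive. -/
lemma arcSin_le_of_lt {κ κ' : ℝ} {a : ℕ → ℝ} {N : ℕ} (hκ : κ < κ') (ha : ∀ k < N, 0 < a k)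
    (h1 : ∀ k < N, κ' * a k ^ 2 ≤ 1) (hS : ∀ j, 0 < j → j ≤ N → 0 < arcSin κ a j)
    (hS' : ∀ j, 0 < j → j ≤ N → 0 < arcSin κ' a j) {j : ℕ} (hj : 1 ≤ j) (hjN : j ≤ N) :
    arcSin κ' a j ≤ arcSin κ a j ∧ (2 ≤ j → arcSin κ' a j < arcSin κ a j) ∧
      arcCos κ' a j * arcSin κ a j < arcCos κ a j * arcSin κ' a j := by
  have key : ∀ k < N, √(1 - κ' * a k ^ 2) < √(1 - κ * a k ^ 2) := fun k hk => by
    apply Real.sqrt_lt_sqrt (by linarith [h1 k hk])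
    have := pow_pos (ha k hk) 2
    nlinarith
  induction j, hj using Nat.le_induction with
  | base =>
    have := key 0 (by omega)
    have h0 := ha 0 (by omega)
    simp only [arcSin_succ, arcCos_succ, arcSin_zero, arcCos_zero]
    refine ⟨by simp, by simp, ?_⟩
    nlinarith
  | succ j hj ih =>
    obtain ⟨i1, -, i3⟩ := ih (by omega)
    have hc := key j (by omega)
    have ha := ha j (by omega)
    have hs := hS j (by omega) (by omega)
    have hs' := hS' j (by omega) (by omega)
    have ht := hS (j + 1) (by omega) (by omega)
    have ht' := hS' (j + 1) (by omega) (by omega)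
    have e' := Real.sq_sqrt (sub_nonneg.2 (h1 j (by omega)))
    have e := Real.sq_sqrt (show 0 ≤ 1 - κ * a j ^ 2 by
      have := h1 j (by omega); nlinarith [sq_nonneg (a j)])
    -- the cotangent recursion, multiplied by its denominators
    have g : a j * arcCos κ a (j + 1) = arcSin κ a (j + 1) * √(1 - κ * a j ^ 2) - arcSin κ a j := by
      rw [arcSin_succ, arcCos_succ]; linear_combination -arcSin κ a j * e
    have g' : a j * arcCos κ' a (j + 1)
        = arcSin κ' a (j + 1) * √(1 - κ' * a j ^ 2) - arcSin κ' a j := by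
      rw [arcSin_succ, arcCos_succ]; linear_combination -arcSin κ' a j * e'
    have hr : arcSin κ a j * arcSin κ' a (j + 1) < arcSin κ' a j * arcSin κ a (j + 1) := by
      rw [arcSin_succ, arcSin_succ]
      nlinarith [mul_lt_mul_of_pos_left hc (mul_pos hs hs'), mul_lt_mul_of_pos_left i3 ha]
    have hlt : arcSin κ' a (j + 1) < arcSin κ a (j + 1) := by
      have := mul_le_mul_of_nonneg_right i1 ht.le
      exact lt_of_mul_lt_mul_left (hr.trans_le this) hs.le
    refine ⟨hlt.le, fun _ => hlt, lt_of_mul_lt_mul_left ?_ ha.le⟩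
    rw [← mul_assoc, ← mul_assoc, g, g']
    nlinarith [mul_lt_mul_of_pos_left hc (mul_pos ht ht')]

/-- The half chord of a sum of at least two arcs is strictly decreasing in `κ`. -/
lemma arcSin_lt_of_lt {κ κ' : ℝ} {a : ℕ → ℝ} {N : ℕ} (hN : 2 ≤ N) (hκ : κ < κ')
    (ha : ∀ k < N, 0 < a k) (h1 : ∀ k < N, κ' * a k ^ 2 ≤ 1)
    (hS : ∀ j, 0 < j → j ≤ N → 0 < arcSin κ a j) (hS' : ∀ j, 0 < j → j ≤ N → 0 < arcSin κ' a j) :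
    arcSin κ' a N < arcSin κ a N :=
  (arcSin_le_of_lt hκ ha h1 hS hS' (by omega) le_rfl).2.1 hN

/-- Existence of the curvature parameter: the chord of the first `N` sides takes the value `d`. The
parameter is the first one with this property, which guarantees that none of the partial sums of
arcs has passed the half turn. -/
lemma exists_arcSin_eq {a : ℕ → ℝ} {N : ℕ} {d : ℝ} (hd : 0 < d) (ha : ∀ k < N, 0 < a k)
    (had : ∀ k < N, a k ≤ d) (hlt : d < arcSin (-1) a N) :
    ∃ κ, -1 < κ ∧ (∀ k < N, κ * a k ^ 2 ≤ 1) ∧ arcSin κ a N = d ∧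
      ∀ j, 0 < j → j ≤ N → 0 < arcSin κ a j := by
  have hcont := fun j => (continuous_arcSinCos a j).1
  have hle1 : ∀ κ, κ * d ^ 2 ≤ 1 → ∀ k < N, κ * a k ^ 2 ≤ 1 := fun κ h k hk => by
    have h2 := pow_le_pow_left₀ (ha k hk).le (had k hk) 2
    rcases le_total κ 0 with h0 | h0
    · nlinarith [sq_nonneg (a k)]
    · nlinarith
  have hd2 : 0 < d ^ 2 := by positivity
  have hend : arcSin (1 / d ^ 2) a N ≤ d := by
    have h := arcCos_sq_add (hle1 (1 / d ^ 2) (by rw [one_div_mul_cancel hd2.ne']))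
    have h3 : 1 / d ^ 2 * arcSin (1 / d ^ 2) a N ^ 2 ≤ 1 := by
      nlinarith [sq_nonneg (arcCos (1 / d ^ 2) a N)]
    rw [one_div_mul_eq_div, div_le_one hd2] at h3
    exact le_of_sq_le_sq h3 hd.le
  have hm1 : (-1 : ℝ) ≤ 1 / d ^ 2 := by have : 0 < 1 / d ^ 2 := by positivity
                                        linarith
  have hK : IsCompact (Set.Icc (-1) (1 / d ^ 2) ∩ {κ | arcSin κ a N ≤ d}) :=
    isCompact_Icc.inter_right (isClosed_le (hcont N) continuous_const)
  obtain ⟨κ₁, ⟨hκI, hκd⟩, hleast⟩ := hK.exists_isLeast ⟨1 / d ^ 2, ⟨hm1, le_rfl⟩, hend⟩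
  have hge : ∀ κ ∈ Set.Icc (-1) κ₁, d ≤ arcSin κ a N := fun κ hκ => by
    by_contra! h
    obtain ⟨κ₂, h2, h2'⟩ := intermediate_value_Icc' hκ.1 (hcont N).continuousOn ⟨h.le, hlt.le⟩
    have h3 := hleast ⟨⟨h2.1, h2.2.trans (hκ.2.trans hκI.2)⟩, h2'.le⟩
    have : κ₂ = κ := le_antisymm h2.2 (hκ.2.trans h3)
    subst this
    exact h.ne h2'
  have heq : arcSin κ₁ a N = d := le_antisymm hκd (hge κ₁ ⟨hκI.1, le_rfl⟩)
  have h1 : κ₁ * d ^ 2 ≤ 1 := by rw [← le_div_iff₀ hd2]; exact hκI.2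
  refine ⟨κ₁, lt_of_le_of_ne hκI.1 ?_, hle1 _ h1, heq, ?_⟩
  · rintro rfl
    exact hlt.ne' heq
  by_contra! hneg
  obtain ⟨j, hj, hjN, hjS⟩ := hneg
  have hB : IsCompact (Set.Icc (-1) κ₁ ∩ ⋃ j ∈ Finset.Icc 1 N, {κ | arcSin κ a j ≤ 0}) := by
    refine isCompact_Icc.inter_right (Set.Finite.isClosed_biUnion (Finset.finite_toSet _) ?_)
    exact fun j _ => isClosed_le (hcont j) continuous_const
  obtain ⟨κ, ⟨hκI', hκB⟩, hκl⟩ := hB.exists_isLeast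
    ⟨κ₁, ⟨hκI.1, le_rfl⟩, Set.mem_biUnion (Finset.mem_coe.2 (Finset.mem_Icc.2 ⟨hj, hjN⟩)) hjS⟩
  have hpos : 0 < κ := by
    by_contra! h
    simp only [Set.mem_iUnion, Finset.mem_Icc] at hκB
    obtain ⟨i, hi, hi'⟩ := hκB
    exact absurd hi' (not_le.2
      ((arcSin_pos_of_nonpos h fun k hk => ha k (hk.trans_le hi.2)).1 (by omega)))
  have hnn : ∀ i, 0 < i → i ≤ N → 0 ≤ arcSin κ a i := fun i hi hiN => by
    by_contra! h
    have h0 := (arcSin_pos_of_nonpos (κ := -1) (by norm_num) fun k hk =>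
      ha k (hk.trans_le hiN)).1 hi
    obtain ⟨κ₂, h2, h2'⟩ := intermediate_value_Icc' hκI'.1 (hcont i).continuousOn ⟨h.le, h0.le⟩
    have h3 := hκl ⟨⟨h2.1, h2.2.trans hκI'.2⟩,
      Set.mem_biUnion (Finset.mem_coe.2 (Finset.mem_Icc.2 ⟨hi, hiN⟩)) h2'.le⟩
    have : κ₂ = κ := le_antisymm h2.2 h3
    subst this
    exact h.ne h2'
  simp only [Set.mem_iUnion, Finset.mem_Icc] at hκB
  have hex : ∃ i, (1 ≤ i ∧ i ≤ N) ∧ arcSin κ a i ≤ 0 := by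
    obtain ⟨i, hi, hi'⟩ := hκB
    exact ⟨i, hi, hi'⟩
  -- the first partial sum that has reached the half turn; the next one would be beyond it
  classical
  obtain ⟨⟨hi1, hiN⟩, hi⟩ := Nat.find_spec hex
  have hmin := fun m => Nat.find_min hex (m := m)
  obtain ⟨i, hie⟩ : ∃ i, Nat.find hex = i + 1 := ⟨Nat.find hex - 1, by omega⟩
  rw [hie] at hi1 hiN hi hmin
  have hi0 : arcSin κ a (i + 1) = 0 := le_antisymm hi (hnn _ (by omega) hiN)
  have hai := ha i (by omega)
  rcases Nat.eq_zero_or_pos i with rfl | hipos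
  · simp [arcSin_succ] at hi0
    linarith
  have hSi : 0 < arcSin κ a i := by
    by_contra! h
    exact hmin i (by omega) ⟨⟨hipos, by omega⟩, h⟩
  have hC : arcCos κ a i ≤ 0 := by
    rw [arcSin_succ] at hi0
    by_contra! h
    nlinarith [mul_pos h hai, mul_nonneg hSi.le (Real.sqrt_nonneg (1 - κ * a i ^ 2))]
  have hC' : arcCos κ a (i + 1) < 0 := by
    rw [arcCos_succ]
    nlinarith [mul_pos (mul_pos hpos hSi) hai,
      mul_nonneg (neg_nonneg.2 hC) (Real.sqrt_nonneg (1 - κ * a i ^ 2))]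
  rcases eq_or_lt_of_le hiN with h | h
  · have := hge κ hκI'
    rw [← h, hi0] at this
    linarith
  · have h4 := hnn (i + 2) (by omega) (by omega)
    rw [arcSin_succ, hi0] at h4
    nlinarith [mul_pos (neg_pos.2 hC') (ha (i + 1) h)]

/-! ### Arcs of inscribed polygons -/

/-- Among arcs of sum less than a quarter turn, a part has a smaller sine than the whole. -/
lemma sin_lt_sin_add {κ s c s' c' : ℝ} (h : c ^ 2 + κ * s ^ 2 = 1) (h' : c' ^ 2 + κ * s' ^ 2 = 1)
    (hs : 0 < s) (hs' : 0 < s') (hS : 0 < s * c' + c * s') (hC : 0 < c * c' - κ * s * s') :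
    s < s * c' + c * s' ∧ 0 < c := by
  have e1 : s = (s * c' + c * s') * c' - (c * c' - κ * s * s') * s' := by
    linear_combination -s * h'
  have e2 : s' = (s * c' + c * s') * c - (c * c' - κ * s * s') * s := by
    linear_combination -s' * h
  have hc' : 0 < c' := by
    have : 0 < (s * c' + c * s') * c' := by nlinarith [mul_pos hC hs']
    exact pos_of_mul_pos_right this hS.le
  have hc : 0 < c := by
    have : 0 < (s * c' + c * s') * c := by nlinarith [mul_pos hC hs]
    exact pos_of_mul_pos_right this hS.le
  refine ⟨?_, hc⟩
  rcases le_or_gt κ 0 with hκ | hκ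
  · have : 1 ≤ c' := by
      by_contra! hlt
      nlinarith [mul_nonneg (neg_nonneg.2 hκ) (sq_nonneg s')]
    nlinarith [mul_pos hc hs']
  · have h1 : c' < 1 := by
      by_contra! hlt
      nlinarith [mul_pos hκ (pow_pos hs' 2)]
    have h2 : c * c' - κ * s * s' < c := by nlinarith [mul_pos (mul_pos hκ hs) hs']
    have h3 : (c * c' - κ * s * s') ^ 2 < c ^ 2 := pow_lt_pow_left₀ h2 hC.le two_ne_zero
    have h4 : (c * c' - κ * s * s') ^ 2 + κ * (s * c' + c * s') ^ 2 = 1 := by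
      linear_combination (c' ^ 2 + κ * s' ^ 2) * h + h'
    have h5 : κ * s ^ 2 < κ * (s * c' + c * s') ^ 2 := by linarith
    exact lt_of_pow_lt_pow_left₀ 2 hS.le (lt_of_mul_lt_mul_left h5 hκ.le)

/-- Monotonicity of the cotangent along an arc: consecutive points in positive order are in
positive order altogether. -/
lemma arc_pos_of_lt {S C : ℕ → ℝ} {N : ℕ} (hS : ∀ j, 0 < j → j ≤ N → 0 < S j)
    (hD : ∀ k, 0 < k → k < N → 0 < S (k + 1) * C k - S k * C (k + 1)) {i j : ℕ} (hi : 0 < i)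
    (hij : i < j) (hj : j ≤ N) : 0 < S j * C i - S i * C j := by
  induction j, hij using Nat.le_induction with
  | base => exact hD i hi (by omega)
  | succ j hij ih =>
    have h1 := ih (by omega)
    have h2 := hD j (by omega) (by omega)
    have hi' := hS i hi (by omega)
    have hj' := hS j (by omega) (by omega)
    have hk := hS (j + 1) (by omega) hj
    refine pos_of_mul_pos_right (a := S j) ?_ hj'.le
    have : S j * (S (j + 1) * C i - S i * C (j + 1)) = S (j + 1) * (S j * C i - S i * C j)
      + S i * (S (j + 1) * C j - S j * C (j + 1)) := by ring
    rw [this]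
    positivity

/-- If points in convex position on a curve of parameter `κ` have a last side that is longest,
then every other side belongs to an arc of at most a quarter turn in the half-arc
parametrisation, so that the points are given by `arcSin` and `arcCos`. -/
lemma eq_arcSin_arcCos {κ : ℝ} {a S C : ℕ → ℝ} {N : ℕ} (hN : 2 ≤ N)
    (hSC : ∀ j ≤ N, C j ^ 2 + κ * S j ^ 2 = 1) (hS0 : S 0 = 0) (hC0 : C 0 = 1)
    (hS : ∀ j, 0 < j → j ≤ N → 0 < S j)
    (hD : ∀ k < N, S (k + 1) * C k - S k * C (k + 1) = a k) (ha : ∀ k < N, 0 < a k)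
    (hmax : ∀ k < N, a k ≤ S N) :
    (∀ k < N, κ * a k ^ 2 ≤ 1) ∧ ∀ j ≤ N, S j = arcSin κ a j ∧ C j = arcCos κ a j := by
  have hcos : ∀ k < N, 0 ≤ C k * C (k + 1) + κ * S k * S (k + 1) := fun k hk => by
    by_contra! hneg
    have e1 := hSC k hk.le
    have e2 := hSC (k + 1) hk
    have e3 := hSC N le_rfl
    have d1 := hD k hk
    have a1 := ha k hk
    have s2 := hS (k + 1) (by omega) hk
    have sN := hS N (by omega) le_rfl
    have m := hmax k hk
    -- the side `k` is at least as long as the diagonal from `k + 1` to `0` (they coincide if `k = 0`)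
    have A : S (k + 1) ≤ a k ∧ 0 < -C (k + 1) ∧ (0 < k → S (k + 1) < a k) := by
      rcases Nat.eq_zero_or_pos k with rfl | hk0
      · simp only [hS0, hC0] at *
        refine ⟨by linarith, by linarith, by omega⟩
      · have h := sin_lt_sin_add (κ := κ) (s := S (k + 1)) (c := -C (k + 1)) (s' := S k) (c' := C k)
          (by linarith) e1 s2 (hS k hk0 hk.le) (by linarith) (by linarith)
        exact ⟨by linarith [h.1], h.2, fun _ => by linarith [h.1]⟩
    -- this diagonal is at least as long as the last side (they coincide if `k + 1 = N`)
    rcases eq_or_lt_of_le (Nat.succ_le_of_lt hk) with hkN | hkN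
    · have := A.2.2 (by omega)
      rw [Nat.succ_eq_add_one] at hkN
      rw [hkN] at this
      linarith
    · have hpos := arc_pos_of_lt hS (fun k _ hk => (hD k hk).symm ▸ ha k hk)
        (i := k + 1) (by omega) hkN le_rfl
      have i1 : S N * (C N * C (k + 1) + κ * S N * S (k + 1))
          + -C N * (S N * C (k + 1) - S (k + 1) * C N) = S (k + 1) := by
        linear_combination S (k + 1) * e3
      have i2 : -C N * (C N * C (k + 1) + κ * S N * S (k + 1))
          - κ * S N * (S N * C (k + 1) - S (k + 1) * C N) = -C (k + 1) := by
        linear_combination -C (k + 1) * e3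
      have h := sin_lt_sin_add (κ := κ) (s := S N) (c := -C N)
        (s' := S N * C (k + 1) - S (k + 1) * C N) (c' := C N * C (k + 1) + κ * S N * S (k + 1))
        (by linarith) (by linear_combination e2 * (C N ^ 2 + κ * S N ^ 2) + e3) sN hpos
        (by linarith) (by linarith [A.2.1])
      linarith [h.1, A.1]
  have hsq : ∀ k < N, (C k * C (k + 1) + κ * S k * S (k + 1)) ^ 2 = 1 - κ * a k ^ 2 :=
    fun k hk => by
      have e1 := hSC k hk.le
      have e2 := hSC (k + 1) hk
      rw [← hD k hk]
      linear_combination e1 * (C (k + 1) ^ 2 + κ * S (k + 1) ^ 2) + e2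
  have hsqrt : ∀ k < N, √(1 - κ * a k ^ 2) = C k * C (k + 1) + κ * S k * S (k + 1) :=
    fun k hk => by rw [← hsq k hk, Real.sqrt_sq (hcos k hk)]
  refine ⟨fun k hk => ?_, fun j => ?_⟩
  · linarith [hsq k hk, sq_nonneg (C k * C (k + 1) + κ * S k * S (k + 1))]
  induction j with
  | zero => exact fun _ => ⟨hS0, hC0⟩
  | succ k ih =>
    intro hk
    obtain ⟨i1, i2⟩ := ih (by omega)
    have e1 := hSC k (by omega)
    rw [arcSin_succ, arcCos_succ, hsqrt k hk, ← i1, ← i2, ← hD k hk]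
    constructor
    · linear_combination -S (k + 1) * e1
    · linear_combination -C (k + 1) * e1

/-! ### The Minkowski form and the hyperbolic plane -/

/-- The determinant of three vectors of `ℝ^{2,1}`. -/
def triple (x y z : Fin 3 → ℝ) : ℝ :=
  x 0 * (y 1 * z 2 - y 2 * z 1) - x 1 * (y 0 * z 2 - y 2 * z 0) + x 2 * (y 0 * z 1 - y 1 * z 0)

/-- The Lorentzian cross product, characterised by `⟨x × y, z⟩ = det (x, y, z)`. -/
def lorentzCross (x y : Fin 3 → ℝ) : Fin 3 → ℝ :=
  ![x 1 * y 2 - x 2 * y 1, x 2 * y 0 - x 0 * y 2, -(x 0 * y 1 - x 1 * y 0)]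

lemma mink_comm (x y : Fin 3 → ℝ) : mink x y = mink y x := by
  unfold mink; ring

lemma mink_smul_left (r : ℝ) (x y : Fin 3 → ℝ) : mink (r • x) y = r * mink x y := by
  simp only [mink, Pi.smul_apply, smul_eq_mul]; ring

lemma mink_smul_self (r : ℝ) (x : Fin 3 → ℝ) : mink (r • x) (r • x) = r ^ 2 * mink x x := by
  simp only [mink, Pi.smul_apply, smul_eq_mul]; ring

lemma mink_lorentzCross (x y z : Fin 3 → ℝ) : mink (lorentzCross x y) z = triple x y z := by
  simp [mink, lorentzCross, triple]; ring

lemma mink_lorentzCross_self (x y : Fin 3 → ℝ) :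
    mink (lorentzCross x y) (lorentzCross x y) = mink x y ^ 2 - mink x x * mink y y := by
  simp [mink, lorentzCross]; ring

/-- The Gram determinant of two triples that share the two vectors `x` and `y`. -/
lemma triple_mul_triple (x y u v : Fin 3 → ℝ) (hx : mink v x = 0) (hy : mink v y = 0) :
    triple x y u * triple x y v = mink v u * (mink x y ^ 2 - mink x x * mink y y) := by
  have : triple x y u * triple x y v = mink v u * (mink x y ^ 2 - mink x x * mink y y)
      + mink v x * (mink x u * mink y y - mink x y * mink y u)
      + mink v y * (mink x x * mink y u - mink x y * mink x u) := by
    unfold triple mink; ring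
  rw [this, hx, hy]; ring

/-- The orthogonal complement of a timelike vector is spacelike. -/
lemma mink_self_pos_of_orthogonal {v y : Fin 3 → ℝ} (hy : mink y y < 0) (h : mink v y = 0)
    (hv : v ≠ 0) : 0 < mink v v := by
  unfold mink at *
  by_contra! hle
  have h1 : v 2 * y 2 = v 0 * y 0 + v 1 * y 1 := by linarith
  have h2 : (v 2 * y 2) ^ 2 ≤ (v 0 ^ 2 + v 1 ^ 2) * (y 0 ^ 2 + y 1 ^ 2) := by
    rw [h1]; nlinarith [sq_nonneg (v 0 * y 1 - v 1 * y 0)]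
  have h3 : v 2 = 0 := by
    by_contra h0
    have h4 : 0 < v 2 ^ 2 := by positivity
    nlinarith [mul_pos h4 (neg_pos.2 hy),
      mul_nonneg (neg_nonneg.2 hle) (add_nonneg (sq_nonneg (y 0)) (sq_nonneg (y 1)))]
  rw [h3] at hle
  have h5 : v 0 = 0 := by nlinarith [sq_nonneg (v 0), sq_nonneg (v 1)]
  have h6 : v 1 = 0 := by nlinarith [sq_nonneg (v 0), sq_nonneg (v 1)]
  exact hv (by ext i; fin_cases i <;> simp [h3, h5, h6])

lemma one_le_neg_mink (x y : HypPlane) : 1 ≤ -mink x y := by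
  obtain ⟨x, hx, hx2⟩ := x
  obtain ⟨y, hy, hy2⟩ := y
  simp only [mink] at hx hy ⊢
  have h1 : x 2 ^ 2 = x 0 ^ 2 + x 1 ^ 2 + 1 := by linarith
  have h2 : y 2 ^ 2 = y 0 ^ 2 + y 1 ^ 2 + 1 := by linarith
  have : (x 0 * y 0 + x 1 * y 1 + 1) ^ 2 ≤ (x 2 * y 2) ^ 2 := by
    rw [mul_pow, h1, h2]
    nlinarith [sq_nonneg (x 0 * y 1 - x 1 * y 0), sq_nonneg (x 0 - y 0), sq_nonneg (x 1 - y 1)]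
  have := le_of_sq_le_sq this (by positivity)
  linarith

lemma one_lt_neg_mink {x y : HypPlane} (h : x ≠ y) : 1 < -mink x y := by
  refine lt_of_le_of_ne (one_le_neg_mink x y) fun he => ?_
  have hx := x.2.1
  have hy := y.2.1
  have h1 : mink (x.1 + y.1) (x.1 + y.1) < 0 := by
    simp only [mink, Pi.add_apply] at *; linarith
  have h2 : mink (x.1 - y.1) (x.1 + y.1) = 0 := by
    simp only [mink, Pi.add_apply, Pi.sub_apply] at *; linarith
  have h3 := mink_self_pos_of_orthogonal h1 h2 (sub_ne_zero.2 fun h' => h (Subtype.ext h'))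
  simp only [mink, Pi.sub_apply] at *
  linarith

lemma cosh_hypDist (x y : HypPlane) : Real.cosh (hypDist x y) = -mink x y :=
  Real.cosh_arcosh (one_le_neg_mink x y)

lemma hypDist_nonneg (x y : HypPlane) : 0 ≤ hypDist x y :=
  Real.arcosh_nonneg (one_le_neg_mink x y)

/-- The half length of a chord of the hyperboloid is `sinh` of the half distance. -/
lemma mink_eq_sinh_half (x y : HypPlane) :
    mink x y = -1 - 2 * Real.sinh (hypDist x y / 2) ^ 2 := by
  have h := cosh_hypDist x y
  rw [show hypDist x y = 2 * (hypDist x y / 2) by ring, Real.cosh_two_mul, Real.cosh_sq] at h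
  linarith

lemma hypDist_eq_of_mink {x y : HypPlane} {L : ℝ} (hL : 0 ≤ L)
    (h : mink x y = -1 - 2 * Real.sinh (L / 2) ^ 2) : hypDist x y = L := by
  have : -mink x y = Real.cosh L := by
    rw [h, show L = 2 * (L / 2) by ring, Real.cosh_two_mul, Real.cosh_sq]; ring_nf
  rw [hypDist, this, Real.arcosh_cosh hL]

/-- A timelike vector is future-directed if it has negative product with a future-directed one. -/
lemma pos_of_mink_neg {x y : Fin 3 → ℝ} (hx : mink x x < 0) (hy : mink y y < 0) (hy2 : 0 < y 2)
    (h : mink x y < 0) : 0 < x 2 := by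
  unfold mink at *
  by_contra! hle
  have h1 : (x 0 * y 0 + x 1 * y 1) ^ 2 ≤ (x 2 * y 2) ^ 2 := by
    nlinarith [sq_nonneg (x 0 * y 1 - x 1 * y 0), mul_pos (neg_pos.2 hx) (neg_pos.2 hy),
      mul_nonneg (neg_pos.2 hx).le (add_nonneg (sq_nonneg (y 0)) (sq_nonneg (y 1))),
      mul_nonneg (neg_pos.2 hy).le (add_nonneg (sq_nonneg (x 0)) (sq_nonneg (x 1)))]
  have h2 := sq_le_sq.1 h1
  have h3 : x 2 * y 2 ≤ 0 := mul_nonpos_of_nonpos_of_nonneg hle hy2.le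
  rw [abs_of_nonpos h3] at h2
  linarith [neg_abs_le (x 0 * y 0 + x 1 * y 1)]

/-! ### Orthonormal frames -/

/-- The coordinates with respect to an orthonormal frame `t, e, p` of `ℝ^{2,1}`, with `p` in the
hyperbolic plane, are an isometry of the hyperbolic plane. -/
lemma exists_frame_isometry (p : HypPlane) {t e : Fin 3 → ℝ} (htt : mink t t = 1)
    (hee : mink e e = 1) (hte : mink t e = 0) (htp : mink t p = 0) (hep : mink e p = 0) :
    ∃ φ : HypPlane ≃ HypPlane, (∀ x y, mink (φ x) (φ y) = mink x y) ∧
      (φ p).1 = ![0, 0, 1] ∧ (∀ x, (φ x).1 = ![mink t x, mink e x, -mink p x]) ∧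
      ∀ x y z : HypPlane, triple x y z = triple t e p * triple (φ x) (φ y) (φ z) := by
  obtain ⟨p, hpp, hp2⟩ := p
  simp only at *
  have hGF : !![t 0, t 1, -t 2; e 0, e 1, -e 2; -p 0, -p 1, p 2]
      * !![t 0, e 0, p 0; t 1, e 1, p 1; t 2, e 2, p 2] = (1 : Matrix (Fin 3) (Fin 3) ℝ) := by
    unfold mink at *
    ext i j
    fin_cases i <;> fin_cases j <;> simp [Matrix.mul_apply, Fin.sum_univ_three] <;> linarith
  have hFG := mul_eq_one_comm.1 hGF
  have ent : ∀ i j, _ := fun i j => congrFun (congrFun hFG i) j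
  have e00 := ent 0 0
  have e01 := ent 0 1
  have e02 := ent 0 2
  have e10 := ent 1 0
  have e11 := ent 1 1
  have e12 := ent 1 2
  have e20 := ent 2 0
  have e21 := ent 2 1
  have e22 := ent 2 2
  clear ent
  simp [Matrix.mul_apply, Fin.sum_univ_three] at e00 e01 e02 e10 e11 e12 e20 e21 e22
  -- coordinates and linear combinations are inverse to each other
  let f : (Fin 3 → ℝ) → Fin 3 → ℝ := fun x => ![mink t x, mink e x, -mink p x]
  let g : (Fin 3 → ℝ) → Fin 3 → ℝ := fun y => fun i => y 0 * t i + y 1 * e i + y 2 * p i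
  have hgf : ∀ x, g (f x) = x := fun x => by
    ext i
    fin_cases i <;> simp [f, g, mink]
    · linear_combination x 0 * e00 + x 1 * e01 + x 2 * e02
    · linear_combination x 0 * e10 + x 1 * e11 + x 2 * e12
    · linear_combination x 0 * e20 + x 1 * e21 + x 2 * e22
  have hfg : ∀ y, f (g y) = y := fun y => by
    unfold mink at *
    ext i
    fin_cases i <;> simp [f, g, mink]
    · linear_combination y 0 * htt + y 1 * hte + y 2 * htp
    · linear_combination y 0 * hte + y 1 * hee + y 2 * hep
    · linear_combination -y 0 * htp - y 1 * hep - y 2 * hpp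
  have hg : ∀ x y, mink (g x) (g y) = mink x y := fun x y => by
    simp only [mink, g] at *
    linear_combination x 0 * y 0 * htt + x 1 * y 1 * hee + x 2 * y 2 * hpp
      + (x 0 * y 1 + x 1 * y 0) * hte + (x 0 * y 2 + x 2 * y 0) * htp
      + (x 1 * y 2 + x 2 * y 1) * hep
  have hf : ∀ x y, mink (f x) (f y) = mink x y := fun x y => by rw [← hg, hgf, hgf]
  have hfp : f p = ![0, 0, 1] := by simp [f, htp, hep, hpp]
  refine ⟨⟨fun x => ⟨f x.1, (hf _ _).trans x.2.1, ?_⟩, fun y => ⟨g y.1, (hg _ _).trans y.2.1, ?_⟩,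
    fun x => Subtype.ext (hgf _), fun y => Subtype.ext (hfg _)⟩, fun x y => hf _ _, hfp,
    fun x => rfl, fun x y z => ?_⟩
  · have := one_le_neg_mink ⟨p, hpp, hp2⟩ x
    simp only [f, Matrix.cons_val] at *
    linarith
  · refine pos_of_mink_neg (y := p) (by rw [hg, y.2.1]; norm_num) (by rw [hpp]; norm_num) hp2 ?_
    have hy2 := y.2.2
    have : f (g y.1) 2 = y.1 2 := by rw [hfg]
    simp only [f, Matrix.cons_val] at this
    rw [mink_comm]
    linarith
  · have : triple (g (f x)) (g (f y)) (g (f z)) = triple t e p * triple (f x) (f y) (f z) := by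
      simp only [triple, g]; ring
    rwa [hgf, hgf, hgf] at this

/-- A point `p` of the plane `⟨w, x⟩ = -1`, where `⟨w, w⟩ > -1`, and this plane are mapped to the
point `(0, 0, 1)` and the plane `x₂ = 1 + lam x₁` by an isometry, and orientations can be
prescribed. -/
lemma exists_isometry_normal_form (p : HypPlane) {w : Fin 3 → ℝ} (hw : -1 < mink w w)
    (hwp : mink w p = -1) {ε : ℝ} (hε : ε ≠ 0) :
    ∃ lam > 0, ∃ φ : HypPlane ≃ HypPlane, (∀ x y, mink (φ x) (φ y) = mink x y) ∧
      (φ p).1 = ![0, 0, 1] ∧ (∀ x : HypPlane, mink w x = lam * (φ x).1 1 - (φ x).1 2) ∧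
      ∀ x y z : HypPlane, 0 < ε * triple x y z → 0 < triple (φ x) (φ y) (φ z) := by
  have hpp := p.2.1
  have hlam : 0 < √(1 + mink w w) := Real.sqrt_pos.2 (by linarith)
  have hsq : √(1 + mink w w) ^ 2 = 1 + mink w w := Real.sq_sqrt (by linarith)
  set lam := √(1 + mink w w)
  set e : Fin 3 → ℝ := lam⁻¹ • (w - p.1) with he
  have mink_e : ∀ x, lam * mink e x = mink w x - mink p x := fun x => by
    rw [he, mink_smul_left, mul_inv_cancel_left₀ hlam.ne']
    simp only [mink, Pi.sub_apply]; ring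
  have hep : mink e p = 0 := by
    have := mink_e p
    rw [hwp, hpp, sub_self] at this
    exact (mul_eq_zero.1 this).resolve_left hlam.ne'
  have hee : mink e e = 1 := by
    have h1 := mink_e e
    rw [mink_comm w, mink_comm p, hep, sub_zero] at h1
    have h2 := mink_e w
    rw [mink_comm p.1 w, hwp] at h2
    have h3 : lam ^ 2 * mink e e = lam ^ 2 * 1 := by linear_combination lam * h1 + h2 - hsq
    exact mul_left_cancel₀ (by positivity) h3
  -- the sign of `t` is chosen so that the frame has the orientation of `ε`
  set σ : ℝ := ((SignType.sign ε : SignType) : ℝ) with hσ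
  have hσ2 : σ * σ = 1 := by
    rcases lt_or_gt_of_ne hε with h | h <;> simp [hσ, h]
  have hσε : 0 < ε * σ := by
    rw [hσ, mul_comm, sign_mul_self]; exact abs_pos.2 hε
  have hc : mink (lorentzCross e p) (lorentzCross e p) = 1 := by
    rw [mink_lorentzCross_self, hep, hee, hpp]; norm_num
  obtain ⟨φ, h1, h2, h3, h4⟩ := exists_frame_isometry p (t := σ • lorentzCross e p) (e := e)
    (by rw [mink_smul_self, hc]; linarith) hee
    (by rw [mink_smul_left, mink_lorentzCross]; simp only [triple]; ring)
    (by rw [mink_smul_left, mink_lorentzCross]; simp only [triple]; ring) hep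
  refine ⟨lam, hlam, φ, h1, h2, fun x => ?_, fun x y z h => ?_⟩
  · rw [h3]
    simp only [Matrix.cons_val]
    linarith [mink_e x]
  · have h5 : triple (σ • lorentzCross e p) e p = σ := by
      have : triple (σ • lorentzCross e p) e p
          = σ * mink (lorentzCross e p) (lorentzCross e p) := by
        rw [mink_lorentzCross]; simp only [triple, Pi.smul_apply, smul_eq_mul]; ring
      rw [this, hc, mul_one]
    rw [h4, h5, ← mul_assoc] at h
    exact pos_of_mul_pos_right h hσε.le

/-! ### Curves of constant curvature as plane sections -/

/-- The distance from a geodesic. -/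
lemma isLeast_hypDist_hypLine {ν : Fin 3 → ℝ} (hν : 0 < mink ν ν) (x : HypPlane)
    (hx : 0 < mink ν x) :
    IsLeast (hypDist x '' hypLine ν) (Real.arsinh (mink ν x / √(mink ν ν))) := by
  obtain ⟨x, hxx, hx2⟩ := x
  simp only at *
  set N := mink ν ν with hN
  set m := mink ν x with hm
  have hb : (m / √N) ^ 2 = m ^ 2 / N := by rw [div_pow, Real.sq_sqrt hν.le]
  set s := √(1 + m ^ 2 / N) with hs
  have hs0 : 0 < s := Real.sqrt_pos.2 (by positivity)
  have hss : s ^ 2 = 1 + m ^ 2 / N := Real.sq_sqrt (by positivity)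
  -- the projection of `x` to the plane orthogonal to `ν`
  set x' : Fin 3 → ℝ := x - (m / N) • ν with hx'
  have hx'y : ∀ y, mink x' y = mink x y - m / N * mink ν y := fun y => by
    simp only [hx', mink, Pi.sub_apply, Pi.smul_apply, smul_eq_mul]; ring
  have hx'ν : mink ν x' = 0 := by
    rw [mink_comm, hx'y, ← hN, mink_comm x, ← hm, div_mul_cancel₀ _ hν.ne', sub_self]
  have hx'x : mink x' x = -s ^ 2 := by rw [hx'y, hxx, ← hm, hss]; ring
  have hx'x' : mink x' x' = -s ^ 2 := by rw [hx'y, hx'ν, mink_comm, hx'x]; ring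
  have hx'2 : 0 < x' 2 := pos_of_mink_neg (y := x) (by rw [hx'x']; nlinarith) (by rw [hxx]; norm_num)
    hx2 (by rw [hx'x]; nlinarith)
  have hdist : Real.arsinh (m / √N) = Real.arcosh s := by
    rw [← Real.arcosh_cosh (x := Real.arsinh (m / √N)) (Real.arsinh_nonneg_iff.2 (by positivity)),
      Real.cosh_arsinh, hb]
  have hfoot : mink (s⁻¹ • x') (s⁻¹ • x') = -1 := by
    rw [mink_smul_self, hx'x']; field_simp
  let y₀ : HypPlane := ⟨s⁻¹ • x', hfoot, by
    simp only [Pi.smul_apply, smul_eq_mul]; positivity⟩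
  have hlow : ∀ y ∈ hypLine ν, mink x y = s * mink y₀ y := fun y hy => by
    have hy : mink ν y = 0 := hy
    simp only [y₀]
    rw [mink_smul_left, mul_inv_cancel_left₀ hs0.ne', hx'y, hy]; ring
  have hy₀ : y₀ ∈ hypLine ν := by
    change mink ν (s⁻¹ • x') = 0
    rw [mink_comm, mink_smul_left, mink_comm, hx'ν, mul_zero]
  rw [hdist]
  constructor
  · refine ⟨y₀, hy₀, ?_⟩
    simp only [hypDist]
    rw [hlow y₀ hy₀, y₀.2.1]
    simp
  · rintro _ ⟨y, hy, rfl⟩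
    have h1 := one_le_neg_mink y₀ y
    have h2 := hlow y hy
    simp only [hypDist]
    rw [Real.arcosh_le_arcosh hs0 (by rw [h2]; nlinarith), h2]
    nlinarith

/-- A curve of constant non-zero curvature lies in an affine plane `⟨w, x⟩ = -1` with
`⟨w, w⟩ > -1`. -/
lemma IsConstCurvatureCurve.exists_plane {C : Set HypPlane} (hC : IsConstCurvatureCurve C) :
    ∃ w : Fin 3 → ℝ, -1 < mink w w ∧ ∀ x ∈ C, mink w x = -1 := by
  rcases hC with ⟨c, r, hr, rfl⟩ | ⟨ν, c, hν, -, hc, rfl⟩ | ⟨ν, R, hν, hR, rfl⟩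
  · have hcosh : 1 < Real.cosh r := Real.one_lt_cosh.2 hr.ne'
    refine ⟨(Real.cosh r)⁻¹ • c.1, ?_, fun x hx => ?_⟩
    · rw [mink_smul_self, c.2.1]
      have : (Real.cosh r)⁻¹ < 1 := inv_lt_one_of_one_lt₀ hcosh
      have : 0 < (Real.cosh r)⁻¹ := by positivity
      nlinarith
    · have hx : hypDist x c = r := hx
      rw [mink_smul_left, mink_comm, ← neg_neg (mink x c), ← cosh_hypDist, hx]
      field_simp
  · refine ⟨c⁻¹ • ν, ?_, fun x hx => ?_⟩
    · rw [mink_smul_self, hν]; norm_num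
    · have hx : mink ν x = -c := hx
      rw [mink_smul_left, hx]; field_simp
  · have hm : 0 < √(mink ν ν) * Real.sinh R :=
      mul_pos (Real.sqrt_pos.2 hν) (Real.sinh_pos_iff.2 hR)
    refine ⟨-(√(mink ν ν) * Real.sinh R)⁻¹ • ν, ?_, fun x hx => ?_⟩
    · rw [mink_smul_self]
      have := mul_nonneg (sq_nonneg (-(√(mink ν ν) * Real.sinh R)⁻¹)) hν.le
      linarith
    · have h1 := hx.2.unique (isLeast_hypDist_hypLine hν x hx.1)
      have h2 := Real.sqrt_pos.2 hν
      rw [mink_smul_left, h1, Real.sinh_arsinh, mul_div_cancel₀ _ h2.ne', neg_mul,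
        inv_mul_cancel₀ hx.1.ne']

/-- Conversely, the planes `x₂ = 1 + lam x₁` cut the hyperbolic plane in curves of constant non-zero
curvature: circles, horocycles, and hypercycles for `lam < 1`, `lam = 1`, and `lam > 1`. -/
lemma isConstCurvatureCurve_plane {lam : ℝ} (hlam : 0 < lam) :
    IsConstCurvatureCurve {x : HypPlane | mink ![0, lam, 1] x = -1} := by
  have hw : mink ![0, lam, 1] ![0, lam, 1] = lam ^ 2 - 1 := by simp [mink]; ring
  rcases lt_trichotomy lam 1 with h | h | h
  · have hpos : 0 < 1 - lam ^ 2 := by nlinarith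
    have hlt : √(1 - lam ^ 2) < 1 := by
      rw [Real.sqrt_lt' one_pos]; nlinarith [pow_pos hlam 2]
    have hs := Real.sqrt_pos.2 hpos
    have hsq := Real.sq_sqrt hpos.le
    set s := √(1 - lam ^ 2)
    have h1 : 1 < s⁻¹ := (one_lt_inv₀ hs).2 hlt
    let c : HypPlane := ⟨s⁻¹ • ![0, lam, 1], by
      rw [mink_smul_self, hw]
      field_simp
      linarith, by simp [hs]⟩
    refine Or.inl ⟨c, Real.arcosh s⁻¹, Real.arcosh_pos h1, ?_⟩
    ext x
    simp only [Set.mem_ofPred_eq, hypDist]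
    rw [Real.arcosh_injOn.eq_iff (one_le_neg_mink x c) h1.le, mink_comm x.1]
    change _ ↔ -mink (s⁻¹ • ![0, lam, 1]) x.1 = _
    rw [mink_smul_left]
    constructor
    · intro h; rw [h]; ring
    · intro h
      field_simp at h
      linarith
  · exact Or.inr (Or.inl ⟨![0, lam, 1], 1, by rw [hw, h]; norm_num, by simp, one_pos, rfl⟩)
  · have hpos : 0 < lam ^ 2 - 1 := by nlinarith
    refine Or.inr (Or.inr ⟨(-1 : ℝ) • ![0, lam, 1], Real.arsinh (1 / √(lam ^ 2 - 1)), ?_,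
      Real.arsinh_pos_iff.2 (by positivity), ?_⟩)
    · rw [mink_smul_self, hw]; linarith
    have hN : mink ((-1 : ℝ) • ![0, lam, 1]) ((-1 : ℝ) • ![0, lam, 1]) = lam ^ 2 - 1 := by
      rw [mink_smul_self, hw]; ring
    ext x
    simp only [Set.mem_ofPred_eq]
    constructor
    · intro hx
      have hx1 : mink ((-1 : ℝ) • ![0, lam, 1]) x = 1 := by rw [mink_smul_left, hx]; norm_num
      have hx0 : 0 < mink ((-1 : ℝ) • ![0, lam, 1]) x := by rw [hx1]; exact one_pos
      have := isLeast_hypDist_hypLine (hN ▸ hpos) x hx0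
      rw [hx1, hN] at this
      exact ⟨hx0, this⟩
    · rintro ⟨h1, h2⟩
      have h3 := h2.unique (isLeast_hypDist_hypLine (hN ▸ hpos) x h1)
      rw [hN, Real.arsinh_inj, div_left_inj' (Real.sqrt_pos.2 hpos).ne', mink_smul_left] at h3
      linarith

/-! ### Points of a plane section in standard position -/

/-- The points of the section by the plane `x₂ = 1 + x₁ / √(κ + 1)`, parametrised by the
generalised sine and cosine of half the arc from `(0, 0, 1)`. -/
noncomputable def stdPoint (κ S C : ℝ) : Fin 3 → ℝ :=
  ![2 * S * C, 2 * S ^ 2 * √(κ + 1), 1 + 2 * S ^ 2]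

lemma mink_stdPoint {κ S C S' C' : ℝ} (hκ : -1 < κ) (h : C ^ 2 + κ * S ^ 2 = 1)
    (h' : C' ^ 2 + κ * S' ^ 2 = 1) :
    mink (stdPoint κ S C) (stdPoint κ S' C') = -1 - 2 * (S' * C - S * C') ^ 2 := by
  have hsq := Real.sq_sqrt (show 0 ≤ κ + 1 by linarith)
  simp only [mink, stdPoint, Matrix.cons_val]
  linear_combination 4 * S ^ 2 * S' ^ 2 * hsq + 2 * S' ^ 2 * h + 2 * S ^ 2 * h'

/-- The Vandermonde determinant of three points of a conic. -/
lemma triple_stdPoint {κ S₁ C₁ S₂ C₂ S₃ C₃ : ℝ} (h₁ : C₁ ^ 2 + κ * S₁ ^ 2 = 1)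
    (h₂ : C₂ ^ 2 + κ * S₂ ^ 2 = 1) (h₃ : C₃ ^ 2 + κ * S₃ ^ 2 = 1) :
    triple (stdPoint κ S₁ C₁) (stdPoint κ S₂ C₂) (stdPoint κ S₃ C₃) = 4 * √(κ + 1) *
      ((S₂ * C₁ - S₁ * C₂) * (S₃ * C₂ - S₂ * C₃) * (S₃ * C₁ - S₁ * C₃)) := by
  have e₁ : 1 + 2 * S₁ ^ 2 = C₁ ^ 2 + κ * S₁ ^ 2 + 2 * S₁ ^ 2 := by rw [h₁]
  have e₂ : 1 + 2 * S₂ ^ 2 = C₂ ^ 2 + κ * S₂ ^ 2 + 2 * S₂ ^ 2 := by rw [h₂]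
  have e₃ : 1 + 2 * S₃ ^ 2 = C₃ ^ 2 + κ * S₃ ^ 2 + 2 * S₃ ^ 2 := by rw [h₃]
  simp only [triple, stdPoint, Matrix.cons_val]
  rw [e₁, e₂, e₃]
  ring

lemma exists_eq_stdPoint {lam : ℝ} (hlam : 0 < lam) (x : HypPlane)
    (hx : lam * x.1 1 - x.1 2 = -1) (hne : x.1 ≠ ![0, 0, 1]) :
    ∃ S C, 0 < S ∧ C ^ 2 + ((lam ^ 2)⁻¹ - 1) * S ^ 2 = 1 ∧
      x.1 = stdPoint ((lam ^ 2)⁻¹ - 1) S C := by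
  have hlt : 1 < x.1 2 := by
    have := one_lt_neg_mink (x := x) (y := ⟨![0, 0, 1], by simp [mink], by simp⟩)
      fun h => hne (congrArg Subtype.val h)
    simpa [mink] using this
  have hxx := x.2.1
  have hβ : 0 < (x.1 2 - 1) / 2 := by linarith
  have hS := Real.sqrt_pos.2 hβ
  have hS2 := Real.sq_sqrt hβ.le
  have hμ : √((lam ^ 2)⁻¹ - 1 + 1) = lam⁻¹ := by
    rw [sub_add_cancel, ← inv_pow, Real.sqrt_sq (by positivity)]
  set S := √((x.1 2 - 1) / 2)
  have hx2 : x.1 2 = 1 + 2 * S ^ 2 := by linarith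
  have hx1 : x.1 1 = 2 * S ^ 2 * lam⁻¹ := by
    rw [← div_eq_mul_inv, eq_div_iff hlam.ne']; linarith
  refine ⟨S, x.1 0 / (2 * S), hS, ?_, ?_⟩
  · have : x.1 0 ^ 2 = 4 * S ^ 2 * (1 - ((lam ^ 2)⁻¹ - 1) * S ^ 2) := by
      simp only [mink] at hxx
      rw [hx2, hx1] at hxx
      rw [← inv_pow]
      linear_combination hxx
    rw [div_pow, this]
    field_simp
    ring
  · ext i
    fin_cases i
    · simp [stdPoint]; field_simp
    · simp [stdPoint, hx1, hμ, -sub_add_cancel]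
    · simp [stdPoint, hx2]

/-! ### The normal form of a cyclic polygon -/

/-- A polygon `P 0, …, P N` in a plane section whose last side is longest is isometric to the
standard polygon with the same side lengths, for some curvature parameter `κ`. -/
lemma exists_normal_form {N : ℕ} (hN : 2 ≤ N) {P : ℕ → HypPlane} {a : ℕ → ℝ}
    (hinj : ∀ i ≤ N, ∀ j ≤ N, P i = P j → i = j)
    (hconv : ∀ k < N, ∀ i ≤ N, ∀ j ≤ N, i ≠ k → i ≠ k + 1 → j ≠ k → j ≠ k + 1 →
      0 < triple (P k) (P (k + 1)) (P i) * triple (P k) (P (k + 1)) (P j))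
    {w : Fin 3 → ℝ} (hw : -1 < mink w w) (hwP : ∀ j ≤ N, mink w (P j) = -1)
    (ha : ∀ k < N, Real.sinh (hypDist (P k) (P (k + 1)) / 2) = a k)
    (haN : Real.sinh (hypDist (P N) (P 0) / 2) = a N) (hmax : ∀ k < N, a k ≤ a N) :
    ∃ κ, -1 < κ ∧ (∀ k < N, κ * a k ^ 2 ≤ 1) ∧ (∀ j, 0 < j → j ≤ N → 0 < arcSin κ a j) ∧
      arcSin κ a N = a N ∧ ∃ φ : HypPlane ≃ HypPlane, (∀ x y, mink (φ x) (φ y) = mink x y) ∧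
        ∀ j ≤ N, (φ (P j)).1 = stdPoint κ (arcSin κ a j) (arcCos κ a j) := by
  have hε := hconv 1 (by omega) 0 (by omega) 0 (by omega) (by omega) (by omega) (by omega)
    (by omega)
  -- all triangles formed by a side and the vertex `0` have the same orientation
  have hor : ∀ k, 1 ≤ k → k < N →
      0 < triple (P 1) (P (1 + 1)) (P 0) * triple (P k) (P (k + 1)) (P 0) := fun k hk => by
    induction k, hk using Nat.le_induction with
    | base => exact fun _ => hε
    | succ k hk ih =>
      intro hkN
      have h1 := ih (by omega)
      have h2 := hconv k (by omega) 0 (by omega) (k + 2) (by omega) (by omega) (by omega)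
        (by omega) (by omega)
      have h3 := hconv (k + 1) (by omega) k (by omega) 0 (by omega) (by omega) (by omega)
        (by omega) (by omega)
      have h4 : triple (P (k + 1)) (P (k + 1 + 1)) (P k) = triple (P k) (P (k + 1)) (P (k + 2)) := by
        simp only [triple]; ring
      rw [h4] at h3
      have h5 := mul_pos (mul_pos h1 h2) h3
      refine pos_of_mul_pos_right (a := triple (P k) (P (k + 1)) (P 0) ^ 2 *
        triple (P k) (P (k + 1)) (P (k + 2)) ^ 2) ?_ (by positivity)
      linarith
  have hε0 : triple (P 1) (P (1 + 1)) (P 0) ≠ 0 := fun h => by simp [h] at hε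
  obtain ⟨lam, hlam, φ, hφ, hφ0, hφw, hφt⟩ :=
    exists_isometry_normal_form (P 0) hw (hwP 0 (by omega)) hε0
  set κ := (lam ^ 2)⁻¹ - 1 with hκ
  have hκ1 : -1 < κ := by have : 0 < (lam ^ 2)⁻¹ := by positivity
                          linarith
  have hex : ∀ j, ∃ S C : ℝ, (j ≤ N → C ^ 2 + κ * S ^ 2 = 1 ∧ (φ (P j)).1 = stdPoint κ S C ∧
      (0 < j → 0 < S)) ∧ (j = 0 → S = 0 ∧ C = 1) := fun j => by
    rcases Nat.eq_zero_or_pos j with rfl | hj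
    · exact ⟨0, 1, fun _ => ⟨by simp, by rw [hφ0]; simp [stdPoint], by simp⟩, fun _ => ⟨rfl, rfl⟩⟩
    by_cases hjN : j ≤ N
    · obtain ⟨S, C, h1, h2, h3⟩ := exists_eq_stdPoint hlam (φ (P j))
        (by rw [← hφw, hwP j hjN]) fun h => hj.ne' (hinj j hjN 0 (by omega)
          (φ.injective (Subtype.ext (h.trans hφ0.symm))))
      exact ⟨S, C, fun _ => ⟨h2, h3, fun _ => h1⟩, by omega⟩
    · exact ⟨0, 1, fun h => absurd h hjN, fun _ => ⟨rfl, rfl⟩⟩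
  choose S C hSC h0 using hex
  obtain ⟨hS0, hC0⟩ := h0 0 rfl
  have hS : ∀ j, 0 < j → j ≤ N → 0 < S j := fun j hj hjN => (hSC j hjN).2.2 hj
  have hdist : ∀ i ≤ N, ∀ j ≤ N,
      (S j * C i - S i * C j) ^ 2 = Real.sinh (hypDist (P i) (P j) / 2) ^ 2 := fun i hi j hj => by
    have h1 := hφ (P i) (P j)
    rw [(hSC i hi).2.1, (hSC j hj).2.1, mink_stdPoint hκ1 (hSC i hi).1 (hSC j hj).1,
      mink_eq_sinh_half] at h1
    linarith
  have hnn : ∀ x y, 0 ≤ Real.sinh (hypDist x y / 2) := fun x y =>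
    Real.sinh_nonneg_iff.2 (by linarith [hypDist_nonneg x y])
  have hDpos : ∀ k < N, 0 < S (k + 1) * C k - S k * C (k + 1) := fun k hk => by
    rcases Nat.eq_zero_or_pos k with rfl | hk0
    · simpa [hS0, hC0] using hS 1 (by omega) (by omega)
    · have h1 := hφt _ _ _ (hor k hk0 hk)
      rw [(hSC k hk.le).2.1, (hSC (k + 1) hk).2.1, (hSC 0 (by omega)).2.1,
        triple_stdPoint (hSC k hk.le).1 (hSC (k + 1) hk).1 (hSC 0 (by omega)).1, hS0, hC0] at h1
      have h2 := mul_pos (hS k hk0 hk.le) (hS (k + 1) (by omega) hk)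
      have h3 : 0 ≤ 4 * √(κ + 1) * (S k * S (k + 1)) := by positivity
      refine pos_of_mul_pos_right (a := 4 * √(κ + 1) * (S k * S (k + 1))) ?_ h3
      linarith
  have hD : ∀ k < N, S (k + 1) * C k - S k * C (k + 1) = a k := fun k hk => by
    rw [← ha k hk]
    exact (sq_eq_sq₀ (hDpos k hk).le (hnn _ _)).1 (hdist k hk.le (k + 1) hk)
  have hSN : S N = a N := by
    rw [← haN]
    refine (sq_eq_sq₀ (hS N (by omega) le_rfl).le (hnn _ _)).1 ?_
    rw [← hdist N le_rfl 0 (by omega), hS0, hC0]; ring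
  obtain ⟨h1, h2⟩ := eq_arcSin_arcCos hN (fun j hj => (hSC j hj).1) hS0 hC0 hS hD
    (fun k hk => hD k hk ▸ hDpos k hk) (fun k hk => hSN ▸ hmax k hk)
  refine ⟨κ, hκ1, h1, fun j hj hjN => (h2 j hjN).1 ▸ hS j hj hjN, (h2 N le_rfl).1 ▸ hSN, φ, hφ,
    fun j hj => ?_⟩
  rw [(hSC j hj).2.1, (h2 j hj).1, (h2 j hj).2]

/-! ### Indices modulo the number of sides -/

/-- The `k`-th index after `m` in cyclic order, counted so that `m` itself is the last one. -/
def indexAfter {N : ℕ} (m : Fin (N + 1)) (k : ℕ) : Fin (N + 1) := m + 1 + Fin.ofNat (N + 1) k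

lemma indexAfter_succ {N : ℕ} (m : Fin (N + 1)) (k : ℕ) :
    indexAfter m (k + 1) = indexAfter m k + 1 := by
  have : Fin.ofNat (N + 1) (k + 1) = Fin.ofNat (N + 1) k + 1 := by
    ext; simp [Fin.val_add]
  rw [indexAfter, this, ← add_assoc, indexAfter]

lemma indexAfter_zero {N : ℕ} (m : Fin (N + 1)) : indexAfter m 0 = m + 1 := by
  simp [indexAfter]

lemma indexAfter_last {N : ℕ} (m : Fin (N + 1)) : indexAfter m N = m := by
  have : Fin.ofNat (N + 1) N = Fin.last N := by ext; simp
  rw [indexAfter, this, add_assoc, add_comm 1, Fin.last_add_one, add_zero]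

lemma indexAfter_val {N : ℕ} (m i : Fin (N + 1)) : indexAfter m (i - (m + 1)).val = i := by
  rw [indexAfter, Fin.ofNat_val_eq_self, add_sub_cancel]

lemma val_indexAfter_sub {N : ℕ} (m : Fin (N + 1)) {k : ℕ} (hk : k ≤ N) :
    (indexAfter m k - (m + 1)).val = k := by
  rw [indexAfter, add_sub_cancel_left, Fin.val_ofNat, Nat.mod_eq_of_lt (by omega)]

lemma indexAfter_injOn {N : ℕ} (m : Fin (N + 1)) {i j : ℕ} (hi : i ≤ N) (hj : j ≤ N)
    (h : indexAfter m i = indexAfter m j) : i = j := by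
  rw [← val_indexAfter_sub m hi, h, val_indexAfter_sub m hj]

lemma sum_indexAfter {N : ℕ} (m : Fin (N + 1)) (f : Fin (N + 1) → ℝ) :
    ∑ k ∈ Finset.range N, f (indexAfter m k) = ∑ i ∈ Finset.univ.erase m, f i := by
  have h1 : ∑ k ∈ Finset.range (N + 1), f (indexAfter m k) = ∑ i, f i := by
    rw [← Fin.sum_univ_eq_sum_range (fun k => f (indexAfter m k)),
      ← Equiv.sum_comp (Equiv.addLeft (m + 1)) f]
    simp [indexAfter, add_assoc]
  rw [Finset.sum_range_succ, indexAfter_last, ← Finset.sum_erase_add _ _ (Finset.mem_univ m)] at h1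
  linarith

/-! ### Existence and uniqueness of cyclic polygons -/

/-- The normal form of a cyclic polygon with a longest side `m`. -/
lemma IsCyclicPolygon.exists_normal_form {N : ℕ} (hN : 2 ≤ N) {ℓ : Fin (N + 1) → ℝ}
    {m : Fin (N + 1)} (hmax : ∀ k, ℓ k ≤ ℓ m) {p : Fin (N + 1) → HypPlane}
    (hp : IsCyclicPolygon p) (hpℓ : HasSideLengths p ℓ) :
    ∃ κ, -1 < κ ∧ (∀ k < N, κ * Real.sinh (ℓ (indexAfter m k) / 2) ^ 2 ≤ 1) ∧
      (∀ j, 0 < j → j ≤ N → 0 < arcSin κ (fun k => Real.sinh (ℓ (indexAfter m k) / 2)) j) ∧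
      arcSin κ (fun k => Real.sinh (ℓ (indexAfter m k) / 2)) N = Real.sinh (ℓ m / 2) ∧
      ∃ φ : HypPlane ≃ HypPlane, (∀ x y, mink (φ x) (φ y) = mink x y) ∧
        ∀ j ≤ N, (φ (p (indexAfter m j))).1 =
          stdPoint κ (arcSin κ (fun k => Real.sinh (ℓ (indexAfter m k) / 2)) j)
            (arcCos κ (fun k => Real.sinh (ℓ (indexAfter m k) / 2)) j) := by
  obtain ⟨⟨hinj, hconv⟩, Γ, hΓ, hpΓ⟩ := hp
  obtain ⟨w, hw, hwΓ⟩ := hΓ.exists_plane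
  have h := _root_.exists_normal_form hN (P := fun j => p (indexAfter m j))
    (a := fun k => Real.sinh (ℓ (indexAfter m k) / 2))
    (fun i hi j hj h => indexAfter_injOn m hi hj (hinj h)) ?_ hw (fun j _ => hwΓ _ (hpΓ _))
    (fun k _ => by rw [indexAfter_succ, hpℓ])
    (by rw [indexAfter_zero, indexAfter_last, hpℓ])
    (fun k _ => by
      rw [indexAfter_last]
      exact Real.sinh_le_sinh.2 (by linarith [hmax (indexAfter m k)]))
  · simpa only [indexAfter_last] using h
  intro k hk i hi j hj hik hik' hjk hjk'
  obtain ⟨ν, -, hν1, hν2, hν⟩ := hconv (indexAfter m k)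
  have hν1 : mink ν (p (indexAfter m k)) = 0 := hν1
  have hν2 : mink ν (p (indexAfter m k + 1)) = 0 := hν2
  rw [← indexAfter_succ] at hν hν2
  have hne : p (indexAfter m k) ≠ p (indexAfter m (k + 1)) := fun h => by
    have := indexAfter_injOn m hk.le hk (hinj h)
    omega
  have hgram : 0 < mink (p (indexAfter m k)) (p (indexAfter m (k + 1))) ^ 2
      - mink (p (indexAfter m k)) (p (indexAfter m k))
        * mink (p (indexAfter m (k + 1))) (p (indexAfter m (k + 1))) := by
    rw [(p (indexAfter m k)).2.1, (p (indexAfter m (k + 1))).2.1]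
    nlinarith [one_lt_neg_mink hne]
  have hside : ∀ i ≤ N, i ≠ k → i ≠ k + 1 →
      0 < triple (p (indexAfter m k)) (p (indexAfter m (k + 1))) (p (indexAfter m i))
        * triple (p (indexAfter m k)) (p (indexAfter m (k + 1))) ν := fun i hi h h' => by
    rw [triple_mul_triple _ _ _ _ hν1 hν2]
    exact mul_pos (hν _ (fun e => h (indexAfter_injOn m hi hk.le e))
      fun e => h' (indexAfter_injOn m hi hk e)) hgram
  have hi' := hside i hi hik hik'
  have hj' := hside j hj hjk hjk'
  exact pos_of_mul_pos_left (b := triple (p (indexAfter m k)) (p (indexAfter m (k + 1))) ν ^ 2)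
    (by linarith [mul_pos hi' hj']) (sq_nonneg _)

/-- The standard polygon with the parameter `κ` is a cyclic polygon. -/
lemma exists_isCyclicPolygon {N : ℕ} (hN : 2 ≤ N) {ℓ : Fin (N + 1) → ℝ} (hℓ : ∀ k, 0 < ℓ k)
    {m : Fin (N + 1)} {κ : ℝ} (hκ : -1 < κ)
    (h1 : ∀ k < N, κ * Real.sinh (ℓ (indexAfter m k) / 2) ^ 2 ≤ 1)
    (hS : ∀ j, 0 < j → j ≤ N → 0 < arcSin κ (fun k => Real.sinh (ℓ (indexAfter m k) / 2)) j)
    (hSN : arcSin κ (fun k => Real.sinh (ℓ (indexAfter m k) / 2)) N = Real.sinh (ℓ m / 2)) :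
    ∃ p : Fin (N + 1) → HypPlane, IsCyclicPolygon p ∧ HasSideLengths p ℓ := by
  set a : ℕ → ℝ := fun k => Real.sinh (ℓ (indexAfter m k) / 2) with ha
  have ha0 : ∀ k, 0 < a k := fun k => Real.sinh_pos_iff.2 (by linarith [hℓ (indexAfter m k)])
  have hSC : ∀ j ≤ N, arcCos κ a j ^ 2 + κ * arcSin κ a j ^ 2 = 1 := fun j hj =>
    arcCos_sq_add fun k hk => h1 k (by omega)
  have hside : ∀ k < N, arcSin κ a (k + 1) * arcCos κ a k - arcSin κ a k * arcCos κ a (k + 1)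
      = a k := fun k hk => arcSin_succ_mul_arcCos_sub fun i hi => h1 i (by omega)
  -- all points are in positive order on the conic
  have hD : ∀ i j, i < j → j ≤ N →
      0 < arcSin κ a j * arcCos κ a i - arcSin κ a i * arcCos κ a j := fun i j hij hj => by
    rcases Nat.eq_zero_or_pos i with rfl | hi
    · simpa using hS j hij hj
    · exact arc_pos_of_lt hS (fun k _ hk => (hside k hk).symm ▸ ha0 k) hi hij hj
  let p : Fin (N + 1) → HypPlane := fun i =>
    ⟨stdPoint κ (arcSin κ a (i - (m + 1)).val) (arcCos κ a (i - (m + 1)).val), by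
      rw [mink_stdPoint hκ (hSC _ (by omega)) (hSC _ (by omega))]; ring, by
      simp only [stdPoint, Matrix.cons_val]; positivity⟩
  have hp : ∀ j ≤ N, (p (indexAfter m j)).1 = stdPoint κ (arcSin κ a j) (arcCos κ a j) :=
    fun j hj => by simp only [p, val_indexAfter_sub m hj]
  have hmink : ∀ i ≤ N, ∀ j ≤ N, mink (p (indexAfter m i)) (p (indexAfter m j)) =
      -1 - 2 * (arcSin κ a j * arcCos κ a i - arcSin κ a i * arcCos κ a j) ^ 2 :=
    fun i hi j hj => by rw [hp i hi, hp j hj, mink_stdPoint hκ (hSC i hi) (hSC j hj)]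
  have hμ : 0 < √(κ + 1) := Real.sqrt_pos.2 (by linarith)
  have hex : ∀ k, ∃ i ≤ N, k = indexAfter m i := fun k =>
    ⟨_, by omega, (indexAfter_val m k).symm⟩
  -- the side that starts at the position `i` ends at the position `i'`, which is `0` if `i = N`
  have hnext : ∀ i ≤ N, ∃ i' ≤ N, indexAfter m i + 1 = indexAfter m i' ∧
      ((i < N ∧ i' = i + 1) ∨ (i = N ∧ i' = 0)) := fun i hi => by
    rcases hi.lt_or_eq with h | rfl
    · exact ⟨i + 1, h, (indexAfter_succ m i).symm, Or.inl ⟨h, rfl⟩⟩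
    · exact ⟨0, by omega, by rw [indexAfter_last, indexAfter_zero], Or.inr ⟨rfl, rfl⟩⟩
  refine ⟨p, ⟨⟨fun x y hxy => ?_, fun k => ?_⟩, _, isConstCurvatureCurve_plane
    (lam := (√(κ + 1))⁻¹) (by positivity), fun k => ?_⟩, fun k => ?_⟩
  · obtain ⟨i, hi, rfl⟩ := hex x
    obtain ⟨j, hj, rfl⟩ := hex y
    have h := hmink i hi j hj
    rw [hxy, (p (indexAfter m j)).2.1] at h
    rcases lt_trichotomy i j with hij | rfl | hij
    · nlinarith [hD i j hij hj]
    · rfl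
    · nlinarith [hD j i hij hi]
  · obtain ⟨i, hi, rfl⟩ := hex k
    obtain ⟨i', hi', he, hcase⟩ := hnext i hi
    rw [he]
    refine ⟨lorentzCross (p (indexAfter m i)) (p (indexAfter m i')), ?_, ?_, ?_, ?_⟩
    · rw [mink_lorentzCross_self, (p (indexAfter m i)).2.1, (p (indexAfter m i')).2.1,
        hmink i hi i' hi']
      have : 0 < (arcSin κ a i' * arcCos κ a i - arcSin κ a i * arcCos κ a i') ^ 2 := by
        rcases hcase with ⟨h, rfl⟩ | ⟨rfl, rfl⟩
        · exact pow_pos (hD i (i + 1) (by omega) h) 2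
        · have := hD 0 i (by omega) le_rfl
          nlinarith
      nlinarith
    · change mink _ _ = 0
      rw [mink_lorentzCross]; simp only [triple]; ring
    · change mink _ _ = 0
      rw [mink_lorentzCross]; simp only [triple]; ring
    · intro j' hj1 hj2
      obtain ⟨j, hj, rfl⟩ := hex j'
      have hji : j ≠ i := fun h => hj1 (by rw [h])
      have hji' : j ≠ i' := fun h => hj2 (by rw [h])
      rw [mink_lorentzCross, hp i hi, hp i' hi', hp j hj,
        triple_stdPoint (hSC i hi) (hSC i' hi') (hSC j hj)]
      refine mul_pos (by positivity) ?_
      rcases hcase with ⟨h, rfl⟩ | ⟨rfl, rfl⟩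
      · have d1 := hD i (i + 1) (by omega) h
        rcases lt_or_gt_of_ne hji with hlt | hgt
        · have d2 := hD j i hlt hi
          have d3 := hD j (i + 1) (by omega) h
          nlinarith [mul_pos (mul_pos d1 d2) d3]
        · have d2 := hD i j hgt hj
          have d3 := hD (i + 1) j (by omega) hj
          exact mul_pos (mul_pos d1 d3) d2
      · have d1 := hD 0 i (by omega) le_rfl
        have d2 := hD 0 j (by omega) hj
        have d3 := hD j i (by omega) le_rfl
        nlinarith [mul_pos (mul_pos d1 d2) d3]
  · change mink _ _ = -1
    simp only [p, mink, stdPoint, Matrix.cons_val]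
    field_simp
    ring
  · obtain ⟨i, hi, rfl⟩ := hex k
    obtain ⟨i', hi', he, hcase⟩ := hnext i hi
    rw [he]
    refine hypDist_eq_of_mink (hℓ _).le ?_
    rw [hmink i hi i' hi']
    rcases hcase with ⟨h, rfl⟩ | ⟨rfl, rfl⟩
    · rw [hside i h]
    · rw [arcSin_zero, arcCos_zero, hSN, indexAfter_last]; ring

/-- The value of the chord for `κ = -1`, which is the length of the straightened path. -/
lemma sinh_half_lt_arcSin_neg_one_iff {N : ℕ} (ℓ : Fin (N + 1) → ℝ) (m : Fin (N + 1)) :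
    Real.sinh (ℓ m / 2) < arcSin (-1) (fun k => Real.sinh (ℓ (indexAfter m k) / 2)) N ↔
      ℓ m < ∑ i ∈ Finset.univ.erase m, ℓ i := by
  rw [(arcSin_neg_one (fun k => ℓ (indexAfter m k) / 2) N).1, Real.sinh_lt_sinh,
    ← Finset.sum_div, sum_indexAfter]
  constructor <;> intro h <;> linarith

/-- It suffices to consider a longest side `m`, and to let it be the last one. Necessity compares
the parameter of the polygon with the value `-1`, uniqueness compares the parameters of the two
polygons, and existence is the intermediate value theorem. -/
theorem theorem3 (n : ℕ) [NeZero n] (hn : 3 ≤ n) (ℓ : Fin n → ℝ) (hℓ : ∀ k, 0 < ℓ k) :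
    ((∃ p : Fin n → HypPlane, IsCyclicPolygon p ∧ HasSideLengths p ℓ) ↔
      ∀ k : Fin n, ℓ k < ∑ i ∈ Finset.univ.erase k, ℓ i) ∧
    (∀ p q : Fin n → HypPlane,
      IsCyclicPolygon p → HasSideLengths p ℓ → IsCyclicPolygon q → HasSideLengths q ℓ →
      ∃ φ : HypPlane ≃ HypPlane,
        (∀ x y : HypPlane, hypDist (φ x) (φ y) = hypDist x y) ∧ ∀ k : Fin n, φ (p k) = q k) := by
  obtain ⟨N, rfl⟩ : ∃ N, n = N + 1 := ⟨n - 1, by omega⟩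
  have hN : 2 ≤ N := by omega
  obtain ⟨m, -, hm⟩ := Finset.exists_max_image Finset.univ ℓ Finset.univ_nonempty
  replace hm : ∀ k, ℓ k ≤ ℓ m := fun k => hm k (Finset.mem_univ k)
  have ha : ∀ k < N, 0 < Real.sinh (ℓ (indexAfter m k) / 2) := fun k _ =>
    Real.sinh_pos_iff.2 (by linarith [hℓ (indexAfter m k)])
  refine ⟨⟨?_, fun h => ?_⟩, fun p q hp hpℓ hq hqℓ => ?_⟩
  · rintro ⟨p, hp, hpℓ⟩ k
    rcases eq_or_ne k m with rfl | hkm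
    · obtain ⟨κ, hκ, h1, hS, hSN, -⟩ := hp.exists_normal_form hN hm hpℓ
      rw [← sinh_half_lt_arcSin_neg_one_iff, ← hSN]
      exact arcSin_lt_of_lt hN hκ ha h1 (fun j hj hjN =>
        (arcSin_pos_of_nonpos (by norm_num) fun i hi => ha i (by omega)).1 hj) hS
    · obtain ⟨j, hjk, hjm⟩ := Fin.exists_ne_and_ne_of_two_lt k m (by omega)
      exact (hm k).trans_lt (Finset.single_lt_sum hjm (Finset.mem_erase.2 ⟨hkm.symm, by simp⟩)
        (Finset.mem_erase.2 ⟨hjk, by simp⟩) (hℓ j) fun i _ _ => (hℓ i).le)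
  · obtain ⟨κ, hκ, h1, hSN, hS⟩ := exists_arcSin_eq
      (Real.sinh_pos_iff.2 (by linarith [hℓ m])) ha
      (fun k _ => Real.sinh_le_sinh.2 (by linarith [hm (indexAfter m k)]))
      ((sinh_half_lt_arcSin_neg_one_iff ℓ m).2 (h m))
    exact exists_isCyclicPolygon hN hℓ hκ h1 hS hSN
  · obtain ⟨κ, -, h1, hS, hSN, φ, hφ, hφp⟩ := hp.exists_normal_form hN hm hpℓ
    obtain ⟨κ', -, h1', hS', hSN', ψ, hψ, hψq⟩ := hq.exists_normal_form hN hm hqℓ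
    have : κ = κ' := by
      rcases lt_trichotomy κ κ' with h | h | h
      · exact absurd (hSN'.trans hSN.symm) (arcSin_lt_of_lt hN h ha h1' hS hS').ne
      · exact h
      · exact absurd (hSN.trans hSN'.symm) (arcSin_lt_of_lt hN h ha h1 hS' hS).ne
    subst this
    refine ⟨φ.trans ψ.symm, fun x y => ?_, fun k => ?_⟩
    · simp only [hypDist, Equiv.trans_apply]
      rw [← hψ, Equiv.apply_symm_apply, Equiv.apply_symm_apply, hφ]
    · rw [Equiv.trans_apply, Equiv.symm_apply_eq, ← indexAfter_val m k]
      exact Subtype.ext ((hφp _ (by omega)).trans (hψq _ (by omega)).symm)
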